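/- **Setting.** Let $k\ge 1$. An unknown distribution $\mathbf p$ on $[2k]=\{1,\dots,2k\}$ is to be learned from $n$ users, user $t$ holding $X_t$, where $X_1,\dots,X_n$ are i.i.d. from $\mathbf p$. Let $\mathcal W$ be a set of channels $W\colon[2k]\to\mathcal Y$ (on input $x$ the output is $y$ with probability $W(y\mid x)$). In a (sequentially) interactive protocol using $\mathcal W$, there is a public random variable $U$, of arbitrary law and independent of the $X_t$; user $t$ selects a channel $W_t\in\mathcal W$ as a function of $(Y_1,\dots,Y_{t-1},U)$ and publishes a message $Y_t$ drawn from $W_t(\cdot\mid X_t)$. The protocol together with an estimator $\hat{\mathbf p}(Y^n,U)$, whose values are distributions on $[2k]$, solves $(2k,\varepsilon)$-distribution learning in $\ell_2$ distance if for every $\mathbf p$ $$\Pr\big[\,\|\hat{\mathbf p}(Y^n,U)-\mathbf p\|_2>\varepsilon\,\big]\le \tfrac1{100}.$$ The sample complexity is the least number $n$ of users for which such a protocol and estimator exist. Let $\mathcal W_\ell$ be the set of all channels $[2k]\to\{0,1\}^\ell$, and let $\mathcal W_\varrho$ be the set of all channels $W\colon[2k]\to\{0,1\}^*$ with $W(y\mid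 x_1)\le e^{\varrho}\,W(y\mid x_2)$ for all $x_1,x_2\in[2k]$ and all $y\in\{0,1\}^*$. **Statement.** There is an absolute constant $c>0$ such that for all integers $k\ge1$ and all $\varepsilon\in(0,1/\sqrt2)$: 1. for every integer $\ell$ with $1\le\ell\le\log_2 k$, the sample complexity of interactive $(2k,\varepsilon)$-distribution learning in $\ell_2$ distance under the communication constraints $\mathcal W_\ell$ is at least $$c\cdot\min\Big\{\frac{k}{\varepsilon^2 2^\ell},\ \frac{1}{\varepsilon^4 2^\ell}\Big\};$$ 2. for every $\varrho\in(0,1]$, the sample complexity of interactive $(2k,\varepsilon)$-distribution learning in $\ell_2$ distance under the local privacy constraints $\mathcal W_\varrho$ is at least $$c\cdot\min\Big\{\frac{k}{\varepsilon^2\varrho^2},\ \frac{1}{\varepsilon^4\varrho^2}\Big\}.$$ -/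

import Mathlib

open scoped ENNReal

universe u

noncomputable section

/-- A channel from `[2k]` to a discrete message space `Y`: `W x y` is the probability `W(y ∣ x)`
of the message `y` when the input is `x`. -/
abbrev Channel (k : ℕ) (Y : Type) : Type := Fin (2 * k) → PMF Y

/-- The `ℓ`-bit communication constraint: all channels whose messages are `ℓ`-bit strings. -/
def commChannels (k ℓ : ℕ) : Set (Channel k (Fin ℓ → Bool)) := Set.univ

/-- The `ϱ`-locally differentially private channels, with finite bit strings as messages. The ratio
condition `W(y ∣ x₁) / W(y ∣ x₂) ≤ exp ϱ` is written without a division. -/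
def ldpChannels (k : ℕ) (ϱ : ℝ) : Set (Channel k (List Bool)) :=
  {W | ∀ (x₁ x₂ : Fin (2 * k)) (y : List Bool),
    W x₁ y ≤ ENNReal.ofReal (Real.exp ϱ) * W x₂ y}

/-- A sequentially interactive protocol with `n` users, channel family `𝒲` and public randomness
in `𝒰`: user `t` chooses an allowed channel as a function of the messages of the users before `t`
and of the public randomness. -/
structure InteractiveProtocol (k n : ℕ) {Y : Type} (𝒲 : Set (Channel k Y))
    (𝒰 : Type u) [MeasurableSpace 𝒰] where
  channel : (t : Fin n) → (Fin t → Y) → 𝒰 → Channel k Y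
  allowed : ∀ t past ω, channel t past ω ∈ 𝒲
  measurable_channel : ∀ t past x y, Measurable fun ω => channel t past ω x y

/-- The messages sent before user `t` speaks. -/
def pastMessages {n : ℕ} {Y : Type} (y : Fin n → Y) (t : Fin n) : Fin t → Y :=
  fun s => y ⟨s, s.2.trans t.2⟩

/-- The probability of the message sequence `y` when the public randomness is `ω` and the inputs
`X₁, …, Xₙ` are independent samples from `p`. -/
def transcriptProb {k n : ℕ} {Y : Type} {𝒲 : Set (Channel k Y)} {𝒰 : Type u} [MeasurableSpace 𝒰]
    (Pr : InteractiveProtocol k n 𝒲 𝒰) (p : PMF (Fin (2 * k))) (ω : 𝒰) (y : Fin n → Y) : ℝ≥0∞ :=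
  ∑ x : Fin n → Fin (2 * k),
    (∏ t, p (x t)) * ∏ t, Pr.channel t (pastMessages y t) ω (x t) (y t)

/-- The `ℓ₂` distance of two probability mass functions. -/
def l2Dist {k : ℕ} (p q : PMF (Fin (2 * k))) : ℝ :=
  Real.sqrt (∑ x, ((p x).toReal - (q x).toReal) ^ 2)

/-- The probability, over the inputs, the channels and the public randomness with law `μ`, that
the estimate `est Yⁿ U` is at `ℓ₂` distance more than `ε` from `p`. -/
def errorProb {k n : ℕ} {Y : Type} {𝒲 : Set (Channel k Y)} {𝒰 : Type u} [MeasurableSpace 𝒰]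
    (μ : MeasureTheory.Measure 𝒰) (Pr : InteractiveProtocol k n 𝒲 𝒰)
    (est : (Fin n → Y) → 𝒰 → PMF (Fin (2 * k))) (ε : ℝ) (p : PMF (Fin (2 * k))) : ℝ≥0∞ :=
  ∫⁻ ω, ∑' y : Fin n → Y,
    Set.indicator {y | ε < l2Dist (est y ω) p} (transcriptProb Pr p ω) y ∂μ

/-- There is an interactive protocol with `n` users and channels in `𝒲`, using public randomness
from some probability space, and an estimator that, whatever the input distribution, is within
`ℓ₂` distance `ε` of it with probability at least `99/100`. -/
def ExistsEstimator (k n : ℕ) {Y : Type} (𝒲 : Set (Channel k Y)) (ε : ℝ) : Prop :=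
  ∃ (𝒰 : Type u) (_ : MeasurableSpace 𝒰) (μ : MeasureTheory.Measure 𝒰)
    (_ : MeasureTheory.IsProbabilityMeasure μ) (Pr : InteractiveProtocol k n 𝒲 𝒰)
    (est : (Fin n → Y) → 𝒰 → PMF (Fin (2 * k))),
    (∀ y x, Measurable fun ω => est y ω x) ∧ ∀ p, errorProb μ Pr est ε p ≤ 1 / 100

/-- The sample complexity of interactive `(2k, ε)`-distribution learning in `ℓ₂` distance under
the constraints `𝒲`: the least number of users (`⊤` if no number suffices). -/
def sampleComplexity (k : ℕ) {Y : Type} (𝒲 : Set (Channel k Y)) (ε : ℝ) : ℕ∞ :=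
  ⨅ (n : ℕ) (_ : ExistsEstimator.{u} k n 𝒲 ε), (n : ℕ∞)

end

/-! The proof is Assouad's method in Hellinger form. Spread mass uniformly over `m` pairs of symbols
and tilt each pair by `γ` in a direction `z i`; a good estimate of the distribution recovers all but
a tenth of the signs. Hence for most `i` the transcript laws under `z` and under `z` with sign `i`
flipped cannot be close, so their affinity `∑ √(P Q)` must on average fall well below `1`
(`sum_affinity_le_hammingDist`).

Interaction is handled by `card_mul_card_le_sum_affinity`. Given the past, the next user applies one
fixed channel, and appending its message costs affinity at most the one-step loss, weighted by `√(P
Q) ≤ (P + Q) / 2`. Averaging over the cube makes the two halves equal, so only the loss summed over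
all `i` for a single channel matters, and adaptivity gives no gain.

That sum is at most `2 ^ ℓ * γ ^ 2 / m` for `ℓ`-bit messages when `γ ≤ 1 / 2`
(`sum_one_sub_affinity_le_card`) and `18 * ϱ ^ 2 * γ ^ 2 / m` for private ones
(`sum_one_sub_affinity_le_ldp`). Writing `J * γ ^ 2 / m` for it, `n` is at least of order `m ^ 2 /
(J * γ ^ 2)`. Separation in `ℓ₂` needs `γ ^ 2` of order `ε ^ 2 * m`, and `γ ≤ 1 / 2` then allows `m`
of order `min k (1 / ε ^ 2)`, which gives both bounds. Large `ε` is treated separately, with `m = 1`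
and `γ = 1`. -/

/-! ### Geometric means and their defect from arithmetic means -/

/-- The geometric mean of two extended nonnegative reals. -/
noncomputable def geomMean (a b : ℝ≥0∞) : ℝ≥0∞ := (a * b) ^ (1 / 2 : ℝ)

theorem geomMean_comm (a b : ℝ≥0∞) : geomMean a b = geomMean b a := by
  rw [geomMean, geomMean, mul_comm]

theorem geomMean_mul_mul (a a' b b' : ℝ≥0∞) :
    geomMean (a * a') (b * b') = geomMean a b * geomMean a' b' := by
  rw [geomMean, geomMean, geomMean, ← ENNReal.mul_rpow_of_nonneg _ _ (by norm_num),
    mul_mul_mul_comm]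

theorem geomMean_ofReal {a b : ℝ} (ha : 0 ≤ a) (hb : 0 ≤ b) :
    geomMean (ENNReal.ofReal a) (ENNReal.ofReal b) = ENNReal.ofReal (Real.sqrt (a * b)) := by
  rw [geomMean, ← ENNReal.ofReal_mul ha, ENNReal.ofReal_rpow_of_nonneg (by positivity) (by norm_num),
    Real.sqrt_eq_rpow]

/-- The weighted arithmetic-geometric mean inequality. -/
theorem geomMean_le (a b : ℝ≥0∞) {s t : ℝ} (hs : 0 < s) (ht : 0 < t) (hst : 1 ≤ 4 * (s * t)) :
    geomMean a b ≤ ENNReal.ofReal s * a + ENNReal.ofReal t * b := by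
  rcases eq_or_ne a ⊤ with rfl | ha
  · rw [ENNReal.mul_top (by simpa using hs)]; simp
  rcases eq_or_ne b ⊤ with rfl | hb
  · rw [ENNReal.mul_top (by simpa using ht)]; simp
  rw [← ENNReal.ofReal_toReal ha, ← ENNReal.ofReal_toReal hb,
    geomMean_ofReal ENNReal.toReal_nonneg ENNReal.toReal_nonneg,
    ← ENNReal.ofReal_mul hs.le, ← ENNReal.ofReal_mul ht.le,
    ← ENNReal.ofReal_add (by positivity) (by positivity)]
  apply ENNReal.ofReal_le_ofReal
  have hx : 0 ≤ a.toReal := ENNReal.toReal_nonneg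
  have hy : 0 ≤ b.toReal := ENNReal.toReal_nonneg
  apply Real.sqrt_le_iff.mpr ⟨by positivity, ?_⟩
  nlinarith [sq_nonneg (s * a.toReal - t * b.toReal), mul_nonneg hx hy,
    mul_le_mul_of_nonneg_right hst (mul_nonneg hx hy)]

theorem geomMean_le_half_add (a b : ℝ≥0∞) : geomMean a b ≤ 2⁻¹ * a + 2⁻¹ * b := by
  have h := geomMean_le a b (s := 2⁻¹) (t := 2⁻¹) (by norm_num) (by norm_num) (by norm_num)
  rwa [ENNReal.ofReal_inv_of_pos two_pos, ENNReal.ofReal_ofNat] at h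

/-- The arithmetic mean exceeds the geometric mean by at most half of `(a - b)² / (a + b)`. -/
theorem half_add_le_geomMean_add {a b : ℝ≥0∞} (ha : a ≠ ⊤) (hb : b ≠ ⊤) :
    2⁻¹ * a + 2⁻¹ * b ≤ geomMean a b +
      ENNReal.ofReal ((a.toReal - b.toReal) ^ 2 / (2 * (a.toReal + b.toReal))) := by
  have hx : 0 ≤ a.toReal := ENNReal.toReal_nonneg
  have hy : 0 ≤ b.toReal := ENNReal.toReal_nonneg
  have h2 : (2⁻¹ : ℝ≥0∞) = ENNReal.ofReal 2⁻¹ := by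
    rw [ENNReal.ofReal_inv_of_pos two_pos, ENNReal.ofReal_ofNat]
  conv_lhs => rw [← ENNReal.ofReal_toReal ha, ← ENNReal.ofReal_toReal hb, h2]
  conv_rhs => enter [1]; rw [← ENNReal.ofReal_toReal ha, ← ENNReal.ofReal_toReal hb]
  rw [geomMean_ofReal hx hy, ← ENNReal.ofReal_mul (by norm_num), ← ENNReal.ofReal_mul (by norm_num),
    ← ENNReal.ofReal_add (by positivity) (by positivity),
    ← ENNReal.ofReal_add (by positivity) (by positivity)]
  apply ENNReal.ofReal_le_ofReal
  generalize a.toReal = x at *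
  generalize b.toReal = y at *
  rcases (add_nonneg hx hy).eq_or_lt with h0 | h0
  · have hx0 : x = 0 := by linarith
    have hy0 : y = 0 := by linarith
    simp [hx0, hy0]
  rw [← sub_le_iff_le_add', le_div_iff₀ (by positivity), Real.sqrt_mul hx]
  obtain ⟨u, hu, rfl⟩ : ∃ u : ℝ, 0 ≤ u ∧ x = u ^ 2 :=
    ⟨Real.sqrt x, Real.sqrt_nonneg _, (Real.sq_sqrt hx).symm⟩
  obtain ⟨v, hv, rfl⟩ : ∃ v : ℝ, 0 ≤ v ∧ y = v ^ 2 :=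
    ⟨Real.sqrt y, Real.sqrt_nonneg _, (Real.sq_sqrt hy).symm⟩
  rw [Real.sqrt_sq hu, Real.sqrt_sq hv]
  -- The claim is `(u - v)² (u² + v²) ≤ (u - v)² (u + v)²`; the two sides differ by `2uv (u - v)²`.
  nlinarith [mul_nonneg (mul_nonneg hu hv) (sq_nonneg (u - v))]

/-! ### Affinity of adaptively generated sequences -/

/-- The probability of the sequence `y` when its `t`-th entry has the law `r t` given the past. -/
noncomputable def adaptiveProb {n : ℕ} {Y : Type} (r : (t : Fin n) → (Fin t → Y) → Y → ℝ≥0∞)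
    (y : Fin n → Y) : ℝ≥0∞ :=
  ∏ t, r t (pastMessages y t) (y t)

theorem adaptiveProb_snoc {n : ℕ} {Y : Type}
    (r : (t : Fin (n + 1)) → (Fin t → Y) → Y → ℝ≥0∞) (y : Fin n → Y) (a : Y) :
    adaptiveProb r (Fin.snoc (α := fun _ => Y) y a) =
      adaptiveProb (fun t : Fin n => r t.castSucc) y * r (Fin.last n) y a := by
  have hpast : ∀ t : Fin n,
      pastMessages (Fin.snoc (α := fun _ => Y) y a) t.castSucc = pastMessages y t := by
    intro t
    funext s
    exact Fin.snoc_castSucc (α := fun _ => Y) a y ⟨s, s.2.trans t.2⟩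
  have hlast : pastMessages (Fin.snoc (α := fun _ => Y) y a) (Fin.last n) = y := by
    funext s
    exact Fin.snoc_castSucc (α := fun _ => Y) a y s
  rw [adaptiveProb, Fin.prod_univ_castSucc, adaptiveProb]
  simp only [hpast, hlast, Fin.snoc_castSucc, Fin.snoc_last]

theorem tsum_snoc {n : ℕ} {Y : Type} (f : (Fin (n + 1) → Y) → ℝ≥0∞) :
    ∑' y, f y = ∑' (y : Fin n → Y) (a : Y), f (Fin.snoc (α := fun _ => Y) y a) := by
  rw [← (Fin.snocEquiv (fun _ : Fin (n + 1) => Y)).tsum_eq f, ENNReal.tsum_prod', ENNReal.tsum_comm]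
  rfl

theorem tsum_adaptiveProb {n : ℕ} {Y : Type} (r : (t : Fin n) → (Fin t → Y) → Y → ℝ≥0∞)
    (hr : ∀ t past, ∑' a, r t past a = 1) : ∑' y, adaptiveProb r y = 1 := by
  induction n with
  | zero => simp [adaptiveProb, tsum_fintype]
  | succ n ih =>
    rw [tsum_snoc]
    simp only [adaptiveProb_snoc, ENNReal.tsum_mul_left]
    refine Eq.trans (tsum_congr fun y => ?_) (ih (fun t => r t.castSucc) fun t => hr t.castSucc)
    exact (congrArg _ (hr (Fin.last n) y)).trans (mul_one _)

/-- Affinities of adaptive laws, averaged over the pairs `z`, `flip i z`, decrease with each step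
by at most the one-step loss `I`. -/
theorem card_mul_card_le_sum_affinity {n : ℕ} {Y Z ι : Type} [Fintype Z] [Fintype ι]
    (flip : ι → Z → Z) (hflip : ∀ i, Function.Involutive (flip i))
    (r : Z → (t : Fin n) → (Fin t → Y) → Y → ℝ≥0∞)
    (hr : ∀ z t past, ∑' a, r z t past a = 1) (I : ℝ≥0∞)
    (hI : ∀ t past z, ∑ i, (1 - ∑' a, geomMean (r z t past a) (r (flip i z) t past a)) ≤ I) :
    (Fintype.card Z * Fintype.card ι : ℝ≥0∞) ≤
      ∑ z, ∑ i, ∑' y, geomMean (adaptiveProb (r z) y) (adaptiveProb (r (flip i z)) y)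
        + Fintype.card Z * (n * I) := by
  induction n with
  | zero => simp [adaptiveProb, geomMean]
  | succ n ih =>
    refine (ih (fun z t => r z t.castSucc) (fun z t => hr z t.castSucc)
      fun t => hI t.castSucc).trans ?_
    set P : Z → (Fin n → Y) → ℝ≥0∞ := fun z => adaptiveProb fun t : Fin n => r z t.castSucc
    have hP : ∀ z, ∑' y, P z y = 1 := fun z => tsum_adaptiveProb _ fun t => hr z t.castSucc
    set D : (Fin n → Y) → Z → ι → ℝ≥0∞ := fun y z i =>
      1 - ∑' a, geomMean (r z (Fin.last n) y a) (r (flip i z) (Fin.last n) y a)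
    have hD : ∀ y z i, D y (flip i z) i = D y z i := by
      intro y z i
      simp only [D, hflip i z]
      congr 1
      exact tsum_congr fun a => geomMean_comm _ _
    -- Affinity is multiplicative in the last step. Multiply by `1 ≤ affinity + D`, then replace the
    -- geometric mean in front of `D` by the arithmetic one.
    have hstep : ∀ z i, ∑' y, geomMean (P z y) (P (flip i z) y) ≤
        ∑' y, geomMean (adaptiveProb (r z) y) (adaptiveProb (r (flip i z)) y) +
          (2⁻¹ * ∑' y, P z y * D y z i + 2⁻¹ * ∑' y, P (flip i z) y * D y (flip i z) i) := by
      intro z i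
      rw [tsum_snoc]
      simp only [adaptiveProb_snoc, geomMean_mul_mul, ENNReal.tsum_mul_left, hD]
      rw [← ENNReal.tsum_mul_left, ← ENNReal.tsum_mul_left, ← ENNReal.tsum_add, ← ENNReal.tsum_add]
      refine ENNReal.tsum_le_tsum fun y => ?_
      calc geomMean (P z y) (P (flip i z) y)
          ≤ geomMean (P z y) (P (flip i z) y) *
            (∑' a, geomMean (r z (Fin.last n) y a) (r (flip i z) (Fin.last n) y a) + D y z i) := by
            conv_lhs => rw [← mul_one (geomMean _ _)]
            gcongr
            exact le_add_tsub
        _ ≤ _ := by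
            rw [mul_add]
            refine add_le_add le_rfl ?_
            rw [← mul_assoc, ← mul_assoc, ← add_mul]
            gcongr
            exact geomMean_le_half_add _ _
    -- The weight `P z y` does not depend on `i`, so for each past `y` the whole sum over `i` falls
    -- under `hI`.
    have hloss : ∑ z, ∑ i, ∑' y, P z y * D y z i ≤ Fintype.card Z * I := by
      calc ∑ z, ∑ i, ∑' y, P z y * D y z i
          = ∑ z, ∑' y, P z y * ∑ i, D y z i := by
            refine Finset.sum_congr rfl fun z _ => ?_
            simp_rw [Finset.mul_sum]
            rw [Summable.tsum_finsetSum fun _ _ => ENNReal.summable]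
        _ ≤ ∑ z, ∑' y, P z y * I := by
            gcongr with z _ y
            exact hI (Fin.last n) y z
        _ = _ := by simp [ENNReal.tsum_mul_right, hP]
    have hsym : ∑ z, ∑ i, ∑' y, P (flip i z) y * D y (flip i z) i =
        ∑ z, ∑ i, ∑' y, P z y * D y z i := by
      rw [Finset.sum_comm, Finset.sum_comm (s := (Finset.univ : Finset Z))]
      refine Finset.sum_congr rfl fun i _ => ?_
      exact Equiv.sum_comp (hflip i).toPerm fun z => ∑' y, P z y * D y z i
    calc _ ≤ ∑ z, ∑ i, (∑' y, geomMean (adaptiveProb (r z) y) (adaptiveProb (r (flip i z)) y) +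
          (2⁻¹ * ∑' y, P z y * D y z i + 2⁻¹ * ∑' y, P (flip i z) y * D y (flip i z) i))
            + Fintype.card Z * (n * I) := by
          gcongr with z _ i
          exact hstep z i
      _ ≤ _ := by
          simp only [Finset.sum_add_distrib, ← Finset.mul_sum]
          rw [hsym, ← add_mul, ENNReal.inv_two_add_inv_two, one_mul, add_assoc]
          gcongr
          calc _ ≤ Fintype.card Z * I + Fintype.card Z * (n * I) := by gcongr
            _ = _ := by push_cast; ring

/-! ### Assouad's lemma on the sign cube -/

/-- The sign vector `z` with its `i`-th entry negated. -/
def flipAt {m : ℕ} (i : Fin m) (z : Fin m → Bool) : Fin m → Bool := Function.update z i (!z i)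

theorem flipAt_same {m : ℕ} (i : Fin m) (z : Fin m → Bool) : flipAt i z i = !z i := by
  simp [flipAt]

theorem flipAt_of_ne {m : ℕ} {i j : Fin m} (h : j ≠ i) (z : Fin m → Bool) :
    flipAt i z j = z j := by
  simp [flipAt, h]

theorem flipAt_involutive {m : ℕ} (i : Fin m) : Function.Involutive (flipAt i) := by
  intro z
  simp [flipAt]

/-- If the affinities of neighbouring hypotheses are large, then every selector has a large
expected Hamming error. -/
theorem sum_affinity_le_hammingDist {m : ℕ} {T : Type} (P : (Fin m → Bool) → T → ℝ≥0∞)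
    (hP : ∀ z, ∑' y, P z y = 1) (sel : T → Fin m → Bool) :
    ∑ z, ∑ i, ∑' y, geomMean (P z y) (P (flipAt i z) y) ≤
      4 * ∑ z, ∑' y, P z y * hammingDist (sel y) z + 4⁻¹ * (2 ^ m * m) := by
  set E : (Fin m → Bool) → Fin m → T → ℝ≥0∞ := fun z i y =>
    P z y * if sel y i ≠ z i then 1 else 0
  -- The selector errs at `i` for exactly one of `z` and `flipAt i z`. That hypothesis gets weight
  -- `2`, the other `1/8`, the least weight allowed by `1 ≤ 4st`.
  have hpt : ∀ z i y, geomMean (P z y) (P (flipAt i z) y) ≤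
      (2 * E z i y + 2 * E (flipAt i z) i y) + (8⁻¹ * P z y + 8⁻¹ * P (flipAt i z) y) := by
    intro z i y
    have h8 : ENNReal.ofReal 8⁻¹ = 8⁻¹ := by
      rw [ENNReal.ofReal_inv_of_pos (by norm_num), ENNReal.ofReal_ofNat]
    by_cases h : sel y i = z i
    · have h' : sel y i ≠ flipAt i z i := by rw [flipAt_same, h]; simp
      have key := geomMean_le (P (flipAt i z) y) (P z y) (s := 2) (t := 8⁻¹)
        (by norm_num) (by norm_num) (by norm_num)
      rw [geomMean_comm, h8, ENNReal.ofReal_ofNat] at key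
      refine key.trans ?_
      simp only [E, if_pos h', mul_one]
      exact add_le_add le_add_self le_self_add
    · have key := geomMean_le (P z y) (P (flipAt i z) y) (s := 2) (t := 8⁻¹)
        (by norm_num) (by norm_num) (by norm_num)
      rw [h8, ENNReal.ofReal_ofNat] at key
      refine key.trans ?_
      simp only [E, if_pos h, ne_eq, mul_one]
      exact add_le_add le_self_add le_add_self
  have hsym : ∀ f : (Fin m → Bool) → Fin m → ℝ≥0∞,
      ∑ z, ∑ i, f (flipAt i z) i = ∑ z, ∑ i, f z i := by
    intro f
    rw [Finset.sum_comm, Finset.sum_comm (s := (Finset.univ : Finset (Fin m → Bool)))]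
    refine Finset.sum_congr rfl fun i _ => ?_
    exact Equiv.sum_comp (flipAt_involutive i).toPerm fun z => f z i
  have hham : ∑ z, ∑ i, ∑' y, E z i y = ∑ z, ∑' y, P z y * hammingDist (sel y) z := by
    refine Finset.sum_congr rfl fun z _ => ?_
    rw [← Summable.tsum_finsetSum fun _ _ => ENNReal.summable]
    refine tsum_congr fun y => ?_
    simp only [E, ← Finset.mul_sum, Finset.sum_boole, hammingDist]
  calc ∑ z, ∑ i, ∑' y, geomMean (P z y) (P (flipAt i z) y)
      ≤ ∑ z, ∑ i, ∑' y, ((2 * E z i y + 2 * E (flipAt i z) i y) +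
          (8⁻¹ * P z y + 8⁻¹ * P (flipAt i z) y)) := by
        gcongr with z _ i _ y
        exact hpt z i y
    _ = (2 * ∑ z, ∑ i, ∑' y, E z i y + 2 * ∑ z, ∑ i, ∑' y, E (flipAt i z) i y) +
          ∑ z : Fin m → Bool, ∑ _i : Fin m, (8⁻¹ + 8⁻¹) := by
        simp only [ENNReal.tsum_add, ENNReal.tsum_mul_left, Finset.sum_add_distrib,
          Finset.mul_sum, hP, mul_one]
    _ = _ := by
        rw [hsym fun z i => ∑' y, E z i y, hham, ← add_mul]
        have h8 : (8⁻¹ + 8⁻¹ : ℝ≥0∞) = 4⁻¹ := by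
          rw [← two_mul, show (8 : ℝ≥0∞) = 2 * 4 by norm_num,
            ENNReal.mul_inv (by norm_num) (by norm_num), ← mul_assoc,
            ENNReal.mul_inv_cancel (by norm_num) (by norm_num), one_mul]
        rw [h8]
        congr 1
        · norm_num
        · simp; ring

/-! ### Protocols and their transcripts -/

/-- The law of the message sent through `W` by a user whose input has the law `p`. -/
noncomputable def messageLaw {k : ℕ} {Y : Type} (p : PMF (Fin (2 * k))) (W : Channel k Y) (y : Y) :
    ℝ≥0∞ :=
  ∑ x, p x * W x y

theorem tsum_messageLaw {k : ℕ} {Y : Type} (p : PMF (Fin (2 * k))) (W : Channel k Y) :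
    ∑' y, messageLaw p W y = 1 := by
  simp only [messageLaw]
  rw [Summable.tsum_finsetSum fun _ _ => ENNReal.summable]
  simp only [ENNReal.tsum_mul_left, PMF.tsum_coe, mul_one]
  rw [← tsum_fintype (L := .unconditional _), p.tsum_coe]

section Protocol

variable {k n : ℕ} {Y : Type} {𝒲 : Set (Channel k Y)} {𝒰 : Type u} [MeasurableSpace 𝒰]

/-- Once the transcript and `ω` are fixed, so are all the channels; as the inputs are independent,
the sum over input vectors factors over the users. -/
theorem transcriptProb_eq_adaptiveProb (Pr : InteractiveProtocol k n 𝒲 𝒰)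
    (p : PMF (Fin (2 * k))) (ω : 𝒰) :
    transcriptProb Pr p ω = adaptiveProb fun t past => messageLaw p (Pr.channel t past ω) := by
  funext y
  simp only [transcriptProb, adaptiveProb, messageLaw, Finset.prod_univ_sum,
    Finset.prod_mul_distrib, Fintype.piFinset_univ]

theorem measurable_transcriptProb (Pr : InteractiveProtocol k n 𝒲 𝒰)
    (p : PMF (Fin (2 * k))) (y : Fin n → Y) : Measurable fun ω => transcriptProb Pr p ω y := by
  unfold transcriptProb
  exact Finset.measurable_sum _ fun x _ => measurable_const.mul <|
    Finset.measurable_prod _ fun t _ => Pr.measurable_channel t _ _ _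

theorem measurable_error [Countable Y] (Pr : InteractiveProtocol k n 𝒲 𝒰)
    (est : (Fin n → Y) → 𝒰 → PMF (Fin (2 * k))) (hest : ∀ y x, Measurable fun ω => est y ω x)
    (ε : ℝ) (p : PMF (Fin (2 * k))) :
    Measurable fun ω => ∑' y : Fin n → Y,
      Set.indicator {y | ε < l2Dist (est y ω) p} (transcriptProb Pr p ω) y := by
  classical
  refine Measurable.tsum fun y => ?_
  simp only [Set.indicator_apply, Set.mem_ofPred_eq]
  refine Measurable.ite ?_ (measurable_transcriptProb Pr p y) measurable_const
  refine measurableSet_lt measurable_const ?_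
  unfold l2Dist
  exact Real.continuous_sqrt.measurable.comp <| Finset.measurable_sum _ fun x _ =>
    ((hest y x).ennreal_toReal.sub measurable_const).pow_const 2

/-- Assouad's bound for a fixed value of the public randomness. -/
theorem card_le_sum_error (Pr : InteractiveProtocol k n 𝒲 𝒰)
    (est : (Fin n → Y) → 𝒰 → PMF (Fin (2 * k))) (ε : ℝ) {m : ℕ}
    (p : (Fin m → Bool) → PMF (Fin (2 * k)))
    (hsep : ∀ q z z', l2Dist q (p z) ≤ ε → l2Dist q (p z') ≤ ε → 10 * hammingDist z z' ≤ m)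
    (I : ℝ≥0∞)
    (hI : 0 < n → ∀ W ∈ 𝒲, ∀ z, ∑ i, (1 - ∑' y, geomMean (messageLaw (p z) W y)
      (messageLaw (p (flipAt i z)) W y)) ≤ I) (ω : 𝒰) :
    (2 ^ m * m : ℝ≥0∞) ≤
      4 * (2 ^ m * (m / 10) + m * ∑ z, ∑' y : Fin n → Y,
        Set.indicator {y | ε < l2Dist (est y ω) (p z)} (transcriptProb Pr (p z) ω) y)
        + 4⁻¹ * (2 ^ m * m) + 2 ^ m * (n * I) := by
  classical
  set P : (Fin m → Bool) → (Fin n → Y) → ℝ≥0∞ := fun z => transcriptProb Pr (p z) ω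
  have hPeq : ∀ z, P z = adaptiveProb fun t past => messageLaw (p z) (Pr.channel t past ω) :=
    fun z => transcriptProb_eq_adaptiveProb Pr (p z) ω
  have hP : ∀ z, ∑' y, P z y = 1 := fun z => by
    rw [hPeq]; exact tsum_adaptiveProb _ fun _ _ => tsum_messageLaw _ _
  -- Any vertex within `ε` of the estimate will do: if the true vertex is also within `ε`,
  -- separation puts the two at Hamming distance at most `m / 10`. Otherwise the trivial bound `m`
  -- is charged to the error event.
  set sel : (Fin n → Y) → Fin m → Bool := fun y =>
    if h : ∃ z, l2Dist (est y ω) (p z) ≤ ε then h.choose else fun _ => false with hsel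
  have hdist : ∀ z y, P z y * hammingDist (sel y) z ≤ P z y * (m / 10) +
      m * Set.indicator {y | ε < l2Dist (est y ω) (p z)} (P z) y := by
    intro z y
    by_cases h : ε < l2Dist (est y ω) (p z)
    · rw [Set.indicator_of_mem (by exact h), mul_comm (m : ℝ≥0∞)]
      refine le_trans ?_ le_add_self
      gcongr
      simpa using hammingDist_le_card_fintype (x := sel y) (y := z)
    · refine le_trans ?_ le_self_add
      have hex : ∃ z, l2Dist (est y ω) (p z) ≤ ε := ⟨z, not_lt.mp h⟩
      have h1 : l2Dist (est y ω) (p (sel y)) ≤ ε := by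
        simp only [hsel, dif_pos hex]; exact hex.choose_spec
      gcongr
      rw [ENNReal.le_div_iff_mul_le (by norm_num) (by norm_num), mul_comm]
      exact_mod_cast hsep _ _ _ h1 (not_lt.mp h)
  have hchain := card_mul_card_le_sum_affinity (n := n) flipAt flipAt_involutive
    (fun z t past => messageLaw (p z) (Pr.channel t past ω)) (fun _ _ _ => tsum_messageLaw _ _) I
    (fun t past z => hI t.pos _ (Pr.allowed t past ω) z)
  simp only [← hPeq] at hchain
  have hsum := sum_affinity_le_hammingDist P hP sel
  simp only [Fintype.card_fun, Fintype.card_bool, Fintype.card_fin, Nat.cast_pow,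
    Nat.cast_ofNat] at hchain
  refine hchain.trans (add_le_add (hsum.trans (add_le_add ?_ le_rfl)) le_rfl)
  gcongr
  calc ∑ z, ∑' y, P z y * hammingDist (sel y) z
      ≤ ∑ z, ∑' y, (P z y * (m / 10) +
          m * Set.indicator {y | ε < l2Dist (est y ω) (p z)} (P z) y) := by
        gcongr with z _ y
        exact hdist z y
    _ = _ := by
        simp [ENNReal.tsum_add, ENNReal.tsum_mul_left, ENNReal.tsum_mul_right,
          Finset.sum_add_distrib, Finset.mul_sum, hP]
        rfl

/-- A protocol that learns a family separated in the sense of Assouad's lemma needs a number of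
users at least proportional to the dimension over the one-step information `I`. -/
theorem le_mul_of_errorProb_le [Countable Y] (μ : MeasureTheory.Measure 𝒰)
    [MeasureTheory.IsProbabilityMeasure μ] (Pr : InteractiveProtocol k n 𝒲 𝒰)
    (est : (Fin n → Y) → 𝒰 → PMF (Fin (2 * k))) (hest : ∀ y x, Measurable fun ω => est y ω x)
    (ε : ℝ) (herr : ∀ p, errorProb μ Pr est ε p ≤ 1 / 100) {m : ℕ}
    (p : (Fin m → Bool) → PMF (Fin (2 * k)))
    (hsep : ∀ q z z', l2Dist q (p z) ≤ ε → l2Dist q (p z') ≤ ε → 10 * hammingDist z z' ≤ m)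
    {I : ℝ} (hI0 : 0 ≤ I)
    (hI : 0 < n → ∀ W ∈ 𝒲, ∀ z, ∑ i, (1 - ∑' y, geomMean (messageLaw (p z) W y)
      (messageLaw (p (flipAt i z)) W y)) ≤ ENNReal.ofReal I) :
    (3 / 10 : ℝ) * m ≤ n * I := by
  have hpt := card_le_sum_error Pr est ε p hsep _ hI
  have hint := MeasureTheory.lintegral_mono (μ := μ) hpt
  have hmeas := fun z => measurable_error Pr est hest ε (p z)
  rw [MeasureTheory.lintegral_const, MeasureTheory.measure_univ, mul_one,
    MeasureTheory.lintegral_add_right _ measurable_const,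
    MeasureTheory.lintegral_add_right _ measurable_const,
    MeasureTheory.lintegral_const_mul' _ _ (by norm_num),
    MeasureTheory.lintegral_add_left measurable_const,
    MeasureTheory.lintegral_const, MeasureTheory.measure_univ, mul_one,
    MeasureTheory.lintegral_const_mul' (m : ℝ≥0∞) _ (by simp),
    MeasureTheory.lintegral_finsetSum _ fun z _ => hmeas z] at hint
  simp only [MeasureTheory.lintegral_const, MeasureTheory.measure_univ, mul_one] at hint
  have hle : (2 ^ m * m : ℝ≥0∞) ≤ 4 * (2 ^ m * (m / 10) + m * (2 ^ m * (1 / 100)))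
      + 4⁻¹ * (2 ^ m * m) + 2 ^ m * (n * ENNReal.ofReal I) := by
    refine hint.trans ?_
    gcongr
    calc _ ≤ ∑ _z : Fin m → Bool, (1 / 100 : ℝ≥0∞) := Finset.sum_le_sum fun z _ => herr (p z)
      _ = _ := by simp
  have hreal := ENNReal.toReal_mono (by finiteness) hle
  have e1 : (4 * (2 ^ m * (m / 10) + m * (2 ^ m * (1 / 100)))
      + 4⁻¹ * (2 ^ m * m) + 2 ^ m * (n * ENNReal.ofReal I) : ℝ≥0∞).toReal =
      4 * (2 ^ m * (m / 10) + m * (2 ^ m * (1 / 100))) + 4⁻¹ * (2 ^ m * m) + 2 ^ m * (n * I) := by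
    rw [ENNReal.toReal_add (by finiteness) (by finiteness),
      ENNReal.toReal_add (by finiteness) (by finiteness), ENNReal.toReal_mul, ENNReal.toReal_add
      (by finiteness) (by finiteness)]
    simp [ENNReal.toReal_ofReal hI0]
  rw [e1] at hreal
  simp only [ENNReal.toReal_mul, ENNReal.toReal_pow, ENNReal.toReal_ofNat,
    ENNReal.toReal_natCast] at hreal
  have h2 : (0 : ℝ) < 2 ^ m := by positivity
  -- The budget is `1 - 4 (1/10 + 1/100) - 1/4 = 31/100 ≥ 3/10`.
  have : (2 : ℝ) ^ m * (3 / 10 * m) ≤ 2 ^ m * (n * I) := by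
    nlinarith [mul_nonneg h2.le (Nat.cast_nonneg (α := ℝ) m)]
  exact le_of_mul_le_mul_left this h2

end Protocol

/-! ### Paired perturbations of the uniform distribution -/

/-- The element of the `i`-th consecutive pair of `Fin (2 * k)` selected by `b`. -/
def pairIndex {m k : ℕ} (hmk : m ≤ k) (a : Fin m × Bool) : Fin (2 * k) :=
  ⟨2 * a.1 + a.2.toNat, by
    have h1 := a.1.2
    have h2 := Bool.toNat_le a.2
    omega⟩

theorem pairIndex_injective {m k : ℕ} (hmk : m ≤ k) : Function.Injective (pairIndex hmk) := by
  rintro ⟨i, b⟩ ⟨j, c⟩ h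
  have h' : 2 * (i : ℕ) + b.toNat = 2 * j + c.toNat := congrArg Fin.val h
  cases b <;> cases c <;> simp_all [Fin.ext_iff] <;> omega

/-- The mass that the perturbed uniform distribution gives to an element of a pair. -/
noncomputable def pairWeight {m : ℕ} (γ : ℝ) (z : Fin m → Bool) (a : Fin m × Bool) : ℝ :=
  (1 + γ * if a.2 = z a.1 then 1 else -1) / (2 * m)

theorem pairWeight_nonneg {m : ℕ} {γ : ℝ} (h0 : 0 ≤ γ) (h1 : γ ≤ 1) (z : Fin m → Bool)
    (a : Fin m × Bool) : 0 ≤ pairWeight γ z a := by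
  unfold pairWeight
  apply div_nonneg _ (by positivity)
  split_ifs <;> linarith

theorem sum_pairWeight {m : ℕ} (hm : 0 < m) (γ : ℝ) (z : Fin m → Bool) :
    ∑ a, pairWeight γ z a = 1 := by
  have hm' : (m : ℝ) ≠ 0 := by positivity
  have h : ∀ i, ∑ b, pairWeight γ z (i, b) = 1 / m := by
    intro i
    rw [Fintype.sum_bool, pairWeight, pairWeight]
    cases z i <;> simp <;> field_simp <;> ring
  rw [Fintype.sum_prod_type]
  simp only [h]
  simp [hm']

/-- The perturbation of the uniform distribution on `m` pairs in the directions `z`. -/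
noncomputable def perturbedPMF {m k : ℕ} (hm : 0 < m) (hmk : m ≤ k) {γ : ℝ} (h0 : 0 ≤ γ)
    (h1 : γ ≤ 1) (z : Fin m → Bool) : PMF (Fin (2 * k)) :=
  (PMF.ofFintype (fun a => ENNReal.ofReal (pairWeight γ z a)) (by
    rw [← ENNReal.ofReal_sum_of_nonneg fun a _ => pairWeight_nonneg h0 h1 z a,
      sum_pairWeight hm, ENNReal.ofReal_one])).map (pairIndex hmk)

section Perturbed

variable {m k : ℕ} (hm : 0 < m) (hmk : m ≤ k) {γ : ℝ} (h0 : 0 ≤ γ) (h1 : γ ≤ 1)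

theorem perturbedPMF_pairIndex (z : Fin m → Bool) (a : Fin m × Bool) :
    (perturbedPMF hm hmk h0 h1 z (pairIndex hmk a)).toReal = pairWeight γ z a := by
  classical
  rw [perturbedPMF, PMF.map_apply, tsum_eq_single a]
  · simp [pairWeight_nonneg h0 h1]
  · intro b hb
    rw [if_neg fun h => hb (pairIndex_injective hmk h).symm]

theorem perturbedPMF_of_notMem (z : Fin m → Bool) {x : Fin (2 * k)}
    (hx : x ∉ Set.range (pairIndex hmk)) : perturbedPMF hm hmk h0 h1 z x = 0 := by
  classical
  rw [perturbedPMF, PMF.map_apply, ENNReal.tsum_eq_zero]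
  intro a
  rw [if_neg fun h => hx ⟨a, h.symm⟩]

theorem toReal_messageLaw_perturbedPMF {Y : Type} (W : Channel k Y) (z : Fin m → Bool) (y : Y) :
    (messageLaw (perturbedPMF hm hmk h0 h1 z) W y).toReal =
      ∑ i, ∑ b, pairWeight γ z (i, b) * (W (pairIndex hmk (i, b)) y).toReal := by
  rw [messageLaw, ENNReal.toReal_sum fun x _ => ENNReal.mul_ne_top (PMF.apply_ne_top _ _)
    (PMF.apply_ne_top _ _), ← Fintype.sum_prod_type']
  symm
  refine Fintype.sum_of_injective (pairIndex hmk) (pairIndex_injective hmk) _ _ ?_ ?_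
  · intro x hx
    simp [perturbedPMF_of_notMem hm hmk h0 h1 z hx]
  · intro a
    simp [perturbedPMF_pairIndex]

theorem messageLaw_ne_top {Y : Type} (p : PMF (Fin (2 * k))) (W : Channel k Y) (y : Y) :
    messageLaw p W y ≠ ⊤ :=
  ENNReal.sum_ne_top.mpr fun _ _ => ENNReal.mul_ne_top (PMF.apply_ne_top _ _)
    (PMF.apply_ne_top _ _)

theorem messageLaw_sub_flipAt {Y : Type} (W : Channel k Y) (z : Fin m → Bool) (i : Fin m) (y : Y) :
    (messageLaw (perturbedPMF hm hmk h0 h1 z) W y).toReal -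
      (messageLaw (perturbedPMF hm hmk h0 h1 (flipAt i z)) W y).toReal =
    γ / m * ((W (pairIndex hmk (i, z i)) y).toReal - (W (pairIndex hmk (i, !z i)) y).toReal) := by
  have hm' : (m : ℝ) ≠ 0 := by positivity
  rw [toReal_messageLaw_perturbedPMF, toReal_messageLaw_perturbedPMF, ← Finset.sum_sub_distrib,
    Finset.sum_eq_single i]
  · simp only [Fintype.sum_bool, pairWeight, flipAt_same]
    cases z i <;> simp <;> field_simp <;> ring
  · intro j _ hj
    simp [pairWeight, flipAt_of_ne hj]
  · simp

theorem l2Dist_sq_perturbedPMF (z z' : Fin m → Bool) :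
    ∑ x, ((perturbedPMF hm hmk h0 h1 z x).toReal - (perturbedPMF hm hmk h0 h1 z' x).toReal) ^ 2 =
      2 * (γ / m) ^ 2 * hammingDist z z' := by
  have hm' : (m : ℝ) ≠ 0 := by positivity
  have h : ∑ a : Fin m × Bool, (pairWeight γ z a - pairWeight γ z' a) ^ 2 =
      ∑ x, ((perturbedPMF hm hmk h0 h1 z x).toReal -
        (perturbedPMF hm hmk h0 h1 z' x).toReal) ^ 2 := by
    refine Fintype.sum_of_injective (pairIndex hmk) (pairIndex_injective hmk) _ _ ?_ ?_
    · intro x hx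
      simp [perturbedPMF_of_notMem hm hmk h0 h1 _ hx]
    · intro a
      simp [perturbedPMF_pairIndex]
  have hi : ∀ i, ∑ b, (pairWeight γ z (i, b) - pairWeight γ z' (i, b)) ^ 2 =
      2 * (γ / m) ^ 2 * if z i ≠ z' i then 1 else 0 := by
    intro i
    rw [Fintype.sum_bool]
    simp only [pairWeight]
    cases z i <;> cases z' i <;> simp <;> field_simp <;> ring
  rw [← h, Fintype.sum_prod_type]
  simp only [hi, ← Finset.mul_sum, Finset.sum_boole, hammingDist]

/-- Both vertices lie near `q`, so `(a - b)² ≤ 2a² + 2b²` puts them at squared distance at most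
`4ε²`, while each differing sign contributes `2 (γ / m)²`. -/
theorem hammingDist_le_of_l2Dist_le {ε : ℝ} {q : PMF (Fin (2 * k))}
    {z z' : Fin m → Bool} (hz : l2Dist q (perturbedPMF hm hmk h0 h1 z) ≤ ε)
    (hz' : l2Dist q (perturbedPMF hm hmk h0 h1 z') ≤ ε) :
    γ ^ 2 * hammingDist z z' ≤ 2 * ε ^ 2 * m ^ 2 := by
  have hm' : (0 : ℝ) < m := by positivity
  have key := l2Dist_sq_perturbedPMF hm hmk h0 h1 z z'
  have e := (Real.sqrt_le_iff.mp hz).2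
  have e' := (Real.sqrt_le_iff.mp hz').2
  have htri : ∑ x, ((perturbedPMF hm hmk h0 h1 z x).toReal -
      (perturbedPMF hm hmk h0 h1 z' x).toReal) ^ 2 ≤
      2 * ∑ x, ((q x).toReal - (perturbedPMF hm hmk h0 h1 z x).toReal) ^ 2 +
      2 * ∑ x, ((q x).toReal - (perturbedPMF hm hmk h0 h1 z' x).toReal) ^ 2 := by
    rw [Finset.mul_sum, Finset.mul_sum, ← Finset.sum_add_distrib]
    refine Finset.sum_le_sum fun x _ => ?_
    nlinarith [sq_nonneg (((q x).toReal - (perturbedPMF hm hmk h0 h1 z x).toReal) +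
      ((q x).toReal - (perturbedPMF hm hmk h0 h1 z' x).toReal))]
  have h4 : 2 * (γ / m) ^ 2 * hammingDist z z' ≤ 4 * ε ^ 2 := by rw [← key]; linarith
  have : 2 * (γ / m) ^ 2 * hammingDist z z' = 2 * (γ ^ 2 * hammingDist z z') / m ^ 2 := by
    field_simp
  rw [this, div_le_iff₀ (by positivity)] at h4
  linarith

/-! ### One-step information bounds -/

/-- The one-step Hellinger losses are bounded through the chi-square type quantities of the
message laws. -/
theorem sum_one_sub_affinity_le {Y : Type} (W : Channel k Y) (p : (Fin m → Bool) → PMF (Fin (2 * k)))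
    (z : Fin m → Bool) (B : Y → ℝ≥0∞)
    (hB : ∀ y, ENNReal.ofReal (∑ i,
      ((messageLaw (p z) W y).toReal - (messageLaw (p (flipAt i z)) W y).toReal) ^ 2 /
        (2 * ((messageLaw (p z) W y).toReal + (messageLaw (p (flipAt i z)) W y).toReal))) ≤ B y) :
    ∑ i, (1 - ∑' y, geomMean (messageLaw (p z) W y) (messageLaw (p (flipAt i z)) W y)) ≤
      ∑' y, B y := by
  set d : Fin m → Y → ℝ := fun i y =>
    ((messageLaw (p z) W y).toReal - (messageLaw (p (flipAt i z)) W y).toReal) ^ 2 /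
        (2 * ((messageLaw (p z) W y).toReal + (messageLaw (p (flipAt i z)) W y).toReal))
  have hd : ∀ i y, 0 ≤ d i y := fun i y => by positivity
  calc _ ≤ ∑ i, ∑' y, ENNReal.ofReal (d i y) := by
        refine Finset.sum_le_sum fun i _ => tsub_le_iff_left.mpr ?_
        calc (1 : ℝ≥0∞) = ∑' y, (2⁻¹ * messageLaw (p z) W y +
              2⁻¹ * messageLaw (p (flipAt i z)) W y) := by
              rw [ENNReal.tsum_add, ENNReal.tsum_mul_left, ENNReal.tsum_mul_left, tsum_messageLaw,
                tsum_messageLaw, mul_one, ENNReal.inv_two_add_inv_two]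
          _ ≤ _ := by
              rw [← ENNReal.tsum_add]
              exact ENNReal.tsum_le_tsum fun y =>
                half_add_le_geomMean_add (messageLaw_ne_top _ _ _) (messageLaw_ne_top _ _ _)
    _ = ∑' y, ENNReal.ofReal (∑ i, d i y) := by
        rw [← Summable.tsum_finsetSum fun _ _ => ENNReal.summable]
        exact tsum_congr fun y => (ENNReal.ofReal_sum_of_nonneg fun i _ => hd i y).symm
    _ ≤ _ := ENNReal.tsum_le_tsum hB

/-- Each message `y` contributes at most `γ² / m`. Flipping sign `i` changes its probability by `γ /
m` times a difference of two channel entries in `[0, 1]`, whose square is at most their sum. Over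
all `i` these sums add up to the total `S` of the entries, which cancels against message
probabilities of at least `S / (4m)`. -/
theorem sum_one_sub_affinity_le_card (hγ : γ ≤ 1 / 2) {Y : Type} [Fintype Y] (W : Channel k Y)
    (z : Fin m → Bool) :
    ∑ i, (1 - ∑' y, geomMean (messageLaw (perturbedPMF hm hmk h0 h1 z) W y)
      (messageLaw (perturbedPMF hm hmk h0 h1 (flipAt i z)) W y)) ≤
        ENNReal.ofReal (Fintype.card Y * (γ ^ 2 / m)) := by
  have hm' : (0 : ℝ) < m := by positivity
  refine (sum_one_sub_affinity_le W _ z (fun _ => ENNReal.ofReal (γ ^ 2 / m)) fun y => ?_).trans ?_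
  · apply ENNReal.ofReal_le_ofReal
    set w : Fin m → Bool → ℝ := fun i b => (W (pairIndex hmk (i, b)) y).toReal with hw
    have hw0 : ∀ i b, 0 ≤ w i b := fun i b => ENNReal.toReal_nonneg
    have hw1 : ∀ i b, w i b ≤ 1 := fun i b =>
      ENNReal.toReal_le_of_le_ofReal zero_le_one (by simpa using PMF.coe_le_one _ _)
    set S := ∑ i, ∑ b, w i b with hS
    have hS0 : 0 ≤ S := Finset.sum_nonneg fun i _ => Finset.sum_nonneg fun b _ => hw0 i b
    -- Every pair weight is at least `(1 - γ) / (2m) ≥ 1 / (4m)`; this is where `γ ≤ 1 / 2` enters.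
    have hlow : ∀ z, S / (4 * m) ≤ (messageLaw (perturbedPMF hm hmk h0 h1 z) W y).toReal := by
      intro z
      rw [toReal_messageLaw_perturbedPMF, hS, Finset.sum_div]
      refine Finset.sum_le_sum fun i _ => ?_
      rw [Finset.sum_div]
      refine Finset.sum_le_sum fun b _ => ?_
      have : 1 / (4 * m) ≤ pairWeight γ z (i, b) := by
        rw [pairWeight, div_le_div_iff₀ (by positivity) (by positivity)]
        split_ifs <;> nlinarith
      calc w i b / (4 * m) = 1 / (4 * m) * w i b := by ring
        _ ≤ _ := mul_le_mul_of_nonneg_right this (hw0 i b)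
    rcases hS0.eq_or_lt with hS0 | hS0
    · have hz : ∀ i b, w i b = 0 := by
        intro i b
        have h := (Finset.sum_eq_zero_iff_of_nonneg fun i _ =>
          Finset.sum_nonneg fun b _ => hw0 i b).mp hS0.symm i (Finset.mem_univ i)
        exact (Finset.sum_eq_zero_iff_of_nonneg fun b _ => hw0 i b).mp h b (Finset.mem_univ b)
      simp only [messageLaw_sub_flipAt]
      have hz' : ∀ i b, (W (pairIndex hmk (i, b)) y).toReal = 0 := hz
      simp only [hz']
      simp
      positivity
    · calc _ ≤ ∑ i, (γ / m) ^ 2 * (∑ b, w i b) / (S / m) := by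
            refine Finset.sum_le_sum fun i _ => ?_
            rw [messageLaw_sub_flipAt]
            have ha := hlow z
            have hb := hlow (flipAt i z)
            apply div_le_div₀
            · have := Finset.sum_nonneg fun b (_ : b ∈ Finset.univ) => hw0 i b
              positivity
            · rw [mul_pow]
              refine mul_le_mul_of_nonneg_left ?_ (by positivity)
              have hsum : ∑ b, w i b = w i (z i) + w i (!z i) := by
                rw [Fintype.sum_bool]; cases z i <;> simp [add_comm]
              rw [hsum]
              change (w i (z i) - w i (!z i)) ^ 2 ≤ _
              nlinarith [hw0 i (z i), hw1 i (z i), hw0 i (!z i), hw1 i (!z i),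
                mul_nonneg (hw0 i (z i)) (hw0 i (!z i))]
            · positivity
            · have : S / m = 2 * (S / (4 * m) + S / (4 * m)) := by field_simp; ring
              rw [this]
              linarith
        _ = γ ^ 2 / m := by
            rw [← Finset.sum_div, ← Finset.mul_sum, ← hS]
            field_simp
  · rw [ENNReal.tsum_const, ENat.card_eq_coe_fintype_card,
      ENNReal.ofReal_mul (Nat.cast_nonneg _), ENNReal.ofReal_natCast]
    exact le_of_eq (by simp)

/-- Privacy makes the entries `W x y` at a fixed `y` agree up to a relative error of order `ϱ`, so
each sign changes the probability `R` of `y` by at most `6ϱR γ / m`. The resulting bound is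
proportional to `R`, and `R` sums to `1` over all messages. Only the law at `z` is kept in the
denominator, so `γ = 1` is allowed. -/
theorem sum_one_sub_affinity_le_ldp {ϱ : ℝ} (hϱ : 0 < ϱ) (hϱ1 : ϱ ≤ 1)
    (W : Channel k (List Bool)) (hW : W ∈ ldpChannels k ϱ) (z : Fin m → Bool) :
    ∑ i, (1 - ∑' y, geomMean (messageLaw (perturbedPMF hm hmk h0 h1 z) W y)
      (messageLaw (perturbedPMF hm hmk h0 h1 (flipAt i z)) W y)) ≤
        ENNReal.ofReal (18 * ϱ ^ 2 * (γ ^ 2 / m)) := by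
  have hm' : (0 : ℝ) < m := by positivity
  refine (sum_one_sub_affinity_le W _ z
    (fun y => ENNReal.ofReal (18 * ϱ ^ 2 * (γ ^ 2 / m)) *
      messageLaw (perturbedPMF hm hmk h0 h1 z) W y) fun y => ?_).trans ?_
  · rw [← ENNReal.ofReal_toReal (messageLaw_ne_top _ _ _), ← ENNReal.ofReal_mul (by positivity)]
    simp only [ENNReal.ofReal_toReal (messageLaw_ne_top _ _ _)]
    apply ENNReal.ofReal_le_ofReal
    -- From `exp ϱ ≤ 1 + ϱ + ϱ²` and `ϱ ≤ 1`.
    have hexp : Real.exp ϱ ≤ 1 + 2 * ϱ := by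
      have := (abs_le.mp (Real.abs_exp_sub_one_sub_id_le (x := ϱ) (by rw [abs_of_pos hϱ]; exact hϱ1))).2
      nlinarith
    set w : Fin m → Bool → ℝ := fun i b => (W (pairIndex hmk (i, b)) y).toReal with hw
    have hw0 : ∀ i b, 0 ≤ w i b := fun i b => ENNReal.toReal_nonneg
    have hratio : ∀ i b j c, w i b ≤ (1 + 2 * ϱ) * w j c := by
      intro i b j c
      have h := ENNReal.toReal_mono (ENNReal.mul_ne_top ENNReal.ofReal_ne_top
        (PMF.apply_ne_top _ _)) (hW (pairIndex hmk (i, b)) (pairIndex hmk (j, c)) y)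
      rw [ENNReal.toReal_mul, ENNReal.toReal_ofReal (Real.exp_pos ϱ).le] at h
      exact h.trans (mul_le_mul_of_nonneg_right hexp (hw0 j c))
    set R := (messageLaw (perturbedPMF hm hmk h0 h1 z) W y).toReal with hR
    have hR0 : 0 ≤ R := ENNReal.toReal_nonneg
    -- `R` is a weighted average of the entries `w j c`, each at least `w i b / 3` because `1 + 2ϱ ≤
    -- 3`.
    have hwR : ∀ i b, w i b ≤ 3 * R := by
      intro i b
      rw [hR, toReal_messageLaw_perturbedPMF, Finset.mul_sum]
      calc w i b = ∑ j, ∑ c, pairWeight γ z (j, c) * w i b := by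
            rw [← Fintype.sum_prod_type' (f := fun j c => pairWeight γ z (j, c) * w i b),
              ← Finset.sum_mul, sum_pairWeight hm, one_mul]
        _ ≤ _ := by
            refine Finset.sum_le_sum fun j _ => ?_
            rw [Finset.mul_sum]
            refine Finset.sum_le_sum fun c _ => ?_
            rw [mul_left_comm]
            refine mul_le_mul_of_nonneg_left ?_ (pairWeight_nonneg h0 h1 _ _)
            exact (hratio i b j c).trans
              (mul_le_mul_of_nonneg_right (by linarith) (hw0 j c))
    calc _ ≤ ∑ _i : Fin m, 18 * ϱ ^ 2 * (γ / m) ^ 2 * R := by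
          refine Finset.sum_le_sum fun i _ => ?_
          rw [hR, messageLaw_sub_flipAt, ← hR]
          have hR' : 0 ≤ (messageLaw (perturbedPMF hm hmk h0 h1 (flipAt i z)) W y).toReal :=
            ENNReal.toReal_nonneg
          have habs : (w i (z i) - w i (!z i)) ^ 2 ≤ (6 * ϱ * R) ^ 2 := by
            apply sq_le_sq'
            · nlinarith [hratio i (!z i) i (z i), hwR i (z i)]
            · nlinarith [hratio i (z i) i (!z i), hwR i (!z i)]
          rcases hR0.eq_or_lt with h | h
          · have hzero : w i (z i) - w i (!z i) = 0 := by
              rw [← h] at habs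
              nlinarith [sq_nonneg (w i (z i) - w i (!z i))]
            change (γ / m * (w i (z i) - w i (!z i))) ^ 2 / _ ≤ _
            rw [hzero]
            simp only [mul_zero, ne_eq, OfNat.ofNat_ne_zero, not_false_eq_true, zero_pow, zero_div]
            positivity
          · change (γ / m * (w i (z i) - w i (!z i))) ^ 2 / _ ≤ _
            rw [div_le_iff₀ (by positivity), mul_pow]
            calc (γ / m) ^ 2 * (w i (z i) - w i (!z i)) ^ 2
                ≤ (γ / m) ^ 2 * (6 * ϱ * R) ^ 2 := by gcongr
              _ = 18 * ϱ ^ 2 * (γ / m) ^ 2 * R * (2 * (R + 0)) := by ring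
              _ ≤ _ := by gcongr
      _ = _ := by
          rw [Finset.sum_const, Finset.card_univ, Fintype.card_fin, nsmul_eq_mul]
          field_simp
  · rw [ENNReal.tsum_mul_left, tsum_messageLaw, mul_one]

end Perturbed

/-! ### Choice of parameters and the sample complexity bounds -/

theorem ofReal_le_sampleComplexity {k : ℕ} {Y : Type} {𝒲 : Set (Channel k Y)} {ε x : ℝ}
    (h : ∀ n, ExistsEstimator.{u} k n 𝒲 ε → x ≤ n) :
    ENNReal.ofReal x ≤ (sampleComplexity.{u} k 𝒲 ε : ℝ≥0∞) := by
  have h1 : ((⌈x⌉₊ : ℕ) : ℕ∞) ≤ sampleComplexity.{u} k 𝒲 ε :=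
    le_iInf₂ fun n hn => Nat.cast_le.mpr (Nat.ceil_le.mpr (h n hn))
  calc ENNReal.ofReal x ≤ ENNReal.ofReal (⌈x⌉₊ : ℝ) := ENNReal.ofReal_le_ofReal (Nat.le_ceil x)
    _ = (((⌈x⌉₊ : ℕ) : ℕ∞) : ℝ≥0∞) := by simp
    _ ≤ _ := ENat.toENNReal_le.mpr h1

/-- The lower bound obtained from the perturbations of the uniform distribution on `m` pairs. -/
theorem ExistsEstimator.le_mul {k n m : ℕ} {Y : Type} [Countable Y] {𝒲 : Set (Channel k Y)}
    {ε : ℝ} (hest : ExistsEstimator.{u} k n 𝒲 ε) (hm : 0 < m) (hmk : m ≤ k) {γ : ℝ} (h0 : 0 ≤ γ)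
    (h1 : γ ≤ 1) (hsep : ∀ h : ℕ, γ ^ 2 * h ≤ 2 * ε ^ 2 * m ^ 2 → 10 * h ≤ m)
    {I : ℝ} (hI0 : 0 ≤ I)
    (hI : 0 < n → ∀ W ∈ 𝒲, ∀ z, ∑ i, (1 - ∑' y,
      geomMean (messageLaw (perturbedPMF hm hmk h0 h1 z) W y)
        (messageLaw (perturbedPMF hm hmk h0 h1 (flipAt i z)) W y)) ≤ ENNReal.ofReal I) :
    (3 / 10 : ℝ) * m ≤ n * I := by
  obtain ⟨𝒰, _, μ, _, Pr, est, hmeas, herr⟩ := hest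
  exact le_mul_of_errorProb_le μ Pr est hmeas ε herr (perturbedPMF hm hmk h0 h1)
    (fun q z z' hz hz' => hsep _ (hammingDist_le_of_l2Dist_le hm hmk h0 h1 hz hz')) hI0 hI

/-- A single pair of point masses separates when `ε < 1 / √2`. -/
theorem separation_one {ε : ℝ} (hε : ε ^ 2 < 1 / 2) (h : ℕ)
    (hh : (1 : ℝ) ^ 2 * h ≤ 2 * ε ^ 2 * (1 : ℕ) ^ 2) : 10 * h ≤ 1 := by
  have h1 : (h : ℝ) < 1 := by
    norm_num at hh
    linarith
  have h2 : h < 1 := by exact_mod_cast h1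
  omega

theorem exists_dimension {k : ℕ} (hk : 1 ≤ k) {ε : ℝ} (hε : 0 < ε) (hε' : ε ^ 2 ≤ 1 / 80) :
    ∃ m : ℕ, 0 < m ∧ m ≤ k ∧ 80 * ε ^ 2 * m ≤ 1 ∧ min (k : ℝ) (1 / ε ^ 2) ≤ 160 * m := by
  have hsq : 0 < ε ^ 2 := by positivity
  have hq : 1 ≤ 1 / (80 * ε ^ 2) := by
    rw [le_div_iff₀ (by positivity)]; linarith
  have hf : 1 ≤ ⌊1 / (80 * ε ^ 2)⌋₊ := Nat.le_floor (by exact_mod_cast hq)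
  refine ⟨min k ⌊1 / (80 * ε ^ 2)⌋₊, by omega, min_le_left _ _, ?_, ?_⟩
  · calc 80 * ε ^ 2 * ((min k ⌊1 / (80 * ε ^ 2)⌋₊ : ℕ) : ℝ)
        ≤ 80 * ε ^ 2 * (1 / (80 * ε ^ 2)) := by
          gcongr
          exact (Nat.cast_le.mpr (min_le_right _ _)).trans (Nat.floor_le (by positivity))
      _ = 1 := by field_simp
  · rcases le_total k ⌊1 / (80 * ε ^ 2)⌋₊ with h | h
    · rw [min_eq_left h]
      refine (min_le_left _ _).trans ?_
      linarith [Nat.cast_nonneg (α := ℝ) k]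
    · rw [min_eq_right h]
      refine (min_le_right _ _).trans ?_
      -- As the floor is at least `1`, rounding down loses at most a factor `2`, which turns `80`
      -- into `160`.
      have h1 := Nat.lt_floor_add_one (1 / (80 * ε ^ 2))
      have h2 : (1 : ℝ) ≤ (⌊1 / (80 * ε ^ 2)⌋₊ : ℝ) := by exact_mod_cast hf
      have h3 : 1 / ε ^ 2 = 80 * (1 / (80 * ε ^ 2)) := by field_simp
      rw [h3]
      linarith

theorem min_div_mul {k : ℕ} {ε : ℝ} (hε : 0 < ε) {A : ℝ} (hA : 0 < A) :
    min ((k : ℝ) / (ε ^ 2 * A)) (1 / (ε ^ 4 * A)) = min (k : ℝ) (1 / ε ^ 2) / (ε ^ 2 * A) := by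
  rw [← min_div_div_right (by positivity)]
  congr 1
  field_simp

/-- The lower bound for families of channels whose one-step information is at most `γ ^ 2 / m`
times a constant `J`. -/
theorem ExistsEstimator.mul_min_le {k n : ℕ} {Y : Type} [Countable Y] {𝒲 : Set (Channel k Y)}
    {ε : ℝ} (hest : ExistsEstimator.{u} k n 𝒲 ε) (hk : 1 ≤ k) (hε : 0 < ε) (hε' : ε ^ 2 ≤ 1 / 80)
    {J : ℝ} (hJ : 0 < J)
    (hI : ∀ (m : ℕ) (hm : 0 < m) (hmk : m ≤ k) (γ : ℝ) (h0 : 0 ≤ γ) (h1 : γ ≤ 1), γ ≤ 1 / 2 →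
      ∀ W ∈ 𝒲, ∀ z, ∑ i, (1 - ∑' y, geomMean (messageLaw (perturbedPMF hm hmk h0 h1 z) W y)
        (messageLaw (perturbedPMF hm hmk h0 h1 (flipAt i z)) W y)) ≤
          ENNReal.ofReal (J * (γ ^ 2 / m))) :
    3 / 32000 * (min (k : ℝ) (1 / ε ^ 2) / (ε ^ 2 * J)) ≤ n := by
  obtain ⟨m, hm, hmk, hm80, hmin⟩ := exists_dimension hk hε hε'
  have hm' : (0 : ℝ) < m := by positivity
  -- With `γ² = 20ε²m`, the separation condition reads `10h ≤ m`, and `80ε²m ≤ 1` gives `γ ≤ 1 / 2`.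
  have hγ2 : Real.sqrt (20 * ε ^ 2 * m) ^ 2 = 20 * ε ^ 2 * m := Real.sq_sqrt (by positivity)
  have hγ : Real.sqrt (20 * ε ^ 2 * m) ≤ 1 / 2 :=
    Real.sqrt_le_iff.mpr ⟨by norm_num, by linarith⟩
  have h0 : 0 ≤ Real.sqrt (20 * ε ^ 2 * m) := Real.sqrt_nonneg _
  have h1 : Real.sqrt (20 * ε ^ 2 * m) ≤ 1 := hγ.trans (by norm_num)
  have key := hest.le_mul hm hmk h0 h1 (fun h hh => ?_) (by positivity)
    (fun _ => hI m hm hmk _ h0 h1 hγ)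
  · rw [hγ2] at key
    have e : J * (20 * ε ^ 2 * m / m) = 20 * (ε ^ 2 * J) := by field_simp
    rw [e] at key
    rw [mul_div_assoc', div_le_iff₀ (by positivity)]
    linarith
  · rw [hγ2] at hh
    have : (10 * h : ℝ) ≤ m := by
      have h2 : (2 * ε ^ 2 * m) * (10 * h) ≤ (2 * ε ^ 2 * m) * m := by linarith
      exact le_of_mul_le_mul_left h2 (by positivity)
    exact_mod_cast this

theorem commChannels_le {k ℓ n : ℕ} {ε : ℝ} (hk : 1 ≤ k) (hε : 0 < ε) (hε' : ε ^ 2 < 1 / 2)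
    (hest : ExistsEstimator.{u} k n (commChannels k ℓ) ε) :
    1 / 10 ^ 6 * min ((k : ℝ) / (ε ^ 2 * 2 ^ ℓ)) (1 / (ε ^ 4 * 2 ^ ℓ)) ≤ (n : ℝ) := by
  have hsq : 0 < ε ^ 2 := by positivity
  rcases le_or_gt (ε ^ 2) (1 / 80) with hs | hs
  · have key := hest.mul_min_le hk hε hs (J := 2 ^ ℓ) (by positivity)
      fun m hm hmk γ h0 h1 hγ W _ z => by
        simpa using sum_one_sub_affinity_le_card hm hmk h0 h1 hγ W z
    rw [min_div_mul hε (by positivity)]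
    refine le_trans ?_ key
    gcongr <;> norm_num
  -- For `ε² > 1/80` the claimed bound is below `1`, so one user is enough. With no users the
  -- one-step hypothesis is vacuous, and `I = 0` yields `3/10 ≤ 0`.
  · have hn : n ≠ 0 := by
      rintro rfl
      have := hest.le_mul one_pos hk zero_le_one le_rfl (separation_one hε') le_rfl
        (fun h => absurd h (lt_irrefl 0))
      norm_num at this
    have hn' : (1 : ℝ) ≤ n := by exact_mod_cast Nat.one_le_iff_ne_zero.mpr hn
    have h2 : (1 : ℝ) ≤ 2 ^ ℓ := one_le_pow₀ one_le_two
    have h4 : 1 / 6400 ≤ ε ^ 4 * 2 ^ ℓ := by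
      have : 1 / 6400 ≤ ε ^ 4 := by nlinarith
      nlinarith
    calc _ ≤ 1 / 10 ^ 6 * (1 / (ε ^ 4 * 2 ^ ℓ)) := by gcongr; exact min_le_right _ _
      _ ≤ 1 / 10 ^ 6 * (1 / (1 / 6400)) := by gcongr
      _ ≤ 1 := by norm_num
      _ ≤ _ := hn'

theorem ldpChannels_le {k n : ℕ} {ε ϱ : ℝ} (hk : 1 ≤ k) (hε : 0 < ε) (hε' : ε ^ 2 < 1 / 2)
    (hϱ : 0 < ϱ) (hϱ1 : ϱ ≤ 1) (hest : ExistsEstimator.{u} k n (ldpChannels k ϱ) ε) :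
    1 / 10 ^ 6 * min ((k : ℝ) / (ε ^ 2 * ϱ ^ 2)) (1 / (ε ^ 4 * ϱ ^ 2)) ≤ n := by
  have hsq : 0 < ε ^ 2 := by positivity
  rcases le_or_gt (ε ^ 2) (1 / 80) with hs | hs
  · have key := hest.mul_min_le hk hε hs (J := 18 * ϱ ^ 2) (by positivity)
      fun m hm hmk γ h0 h1 _ W hW z => sum_one_sub_affinity_le_ldp hm hmk h0 h1 hϱ hϱ1 W hW z
    rw [min_div_mul hε (by positivity)]
    refine le_trans ?_ key
    have e : min (k : ℝ) (1 / ε ^ 2) / (ε ^ 2 * (18 * ϱ ^ 2)) =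
        1 / 18 * (min (k : ℝ) (1 / ε ^ 2) / (ε ^ 2 * ϱ ^ 2)) := by field_simp
    rw [e, ← mul_assoc]
    gcongr
    norm_num
  -- Here `1 ≤ n` would not suffice, since the bound grows like `1 / ϱ²`. Two point masses (`m = 1`,
  -- `γ = 1`) give `3/10 ≤ 18ϱ²n`.
  · have key := hest.le_mul one_pos hk zero_le_one le_rfl (separation_one hε')
      (I := 18 * ϱ ^ 2 * (1 ^ 2 / (1 : ℕ))) (by positivity)
      (fun _ W hW z => sum_one_sub_affinity_le_ldp one_pos hk zero_le_one le_rfl hϱ hϱ1 W hW z)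
    have h4 : 1 / 6400 ≤ ε ^ 4 := by nlinarith
    calc _ ≤ 1 / 10 ^ 6 * (1 / (ε ^ 4 * ϱ ^ 2)) := by gcongr; exact min_le_right _ _
      _ ≤ 1 / 10 ^ 6 * (1 / (1 / 6400 * ϱ ^ 2)) := by gcongr
      _ = 64 / 10 ^ 4 / ϱ ^ 2 := by field_simp; norm_num
      _ ≤ n := by
          rw [div_le_iff₀ (by positivity)]
          norm_num at key
          linarith

theorem mainTheorem12 :
    ∃ c : ℝ, 0 < c ∧ ∀ (k : ℕ) (ε : ℝ), 1 ≤ k → 0 < ε → ε < 1 / Real.sqrt 2 →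
      (∀ ℓ : ℕ, 1 ≤ ℓ → (ℓ : ℝ) ≤ Real.logb 2 k →
        ENNReal.ofReal (c * min ((k : ℝ) / (ε ^ 2 * 2 ^ ℓ)) (1 / (ε ^ 4 * 2 ^ ℓ)))
          ≤ (sampleComplexity.{u} k (commChannels k ℓ) ε : ℝ≥0∞)) ∧
      (∀ ϱ : ℝ, 0 < ϱ → ϱ ≤ 1 →
        ENNReal.ofReal (c * min ((k : ℝ) / (ε ^ 2 * ϱ ^ 2)) (1 / (ε ^ 4 * ϱ ^ 2)))
          ≤ (sampleComplexity.{u} k (ldpChannels k ϱ) ε : ℝ≥0∞)) := by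
  refine ⟨1 / 10 ^ 6, by norm_num, fun k ε hk hε hlt => ?_⟩
  have hε' : ε ^ 2 < 1 / 2 := by
    have h := pow_lt_pow_left₀ hlt hε.le two_ne_zero
    rwa [div_pow, one_pow, Real.sq_sqrt zero_le_two] at h
  exact ⟨fun ℓ _ _ => ofReal_le_sampleComplexity fun n => commChannels_le hk hε hε',
    fun ϱ hϱ hϱ1 => ofReal_le_sampleComplexity fun n => ldpChannels_le hk hε hε' hϱ hϱ1⟩
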